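/- Fix $k\ge 1$ and $\varepsilon\in(0,\tfrac12)$. All alphabets are finite; an input $w\in\Sigma^*$ is given on the tape as $\vdash w\dashv$ with end-markers $\vdash,\dashv\,\notin\Sigma$, the head starts on $\vdash$, and the $k$ integer counters start at $0$. Counters are blind: transitions do not depend on them, and acceptance requires that all of them are $0$ at the end. A one-way deterministic $k$-blind-counter automaton (1D$k$BCA) has a finite state set $Q$, an initial state, a set of accepting states and a transition function that assigns to a state and a scanned symbol a new state, a head move (stay, or one square to the right) and a vector in $\mathbb Z^k$ to be added to the counters. Its computation ends when the head moves past $\dashv$. It accepts $w$ if its computation on $\vdash w\dashv$ ends, in an accepting state and with all counters equal to $0$; it recognizes the language of all words that it accepts. A realtime quantum $k$-blind-counter automaton (rtQ$k$BCA) has a finite state set $Q$, an initial state $q_0$, a set $Q_a\subseteq Q$ of accepting states, a finite register alphabet $\Omega$, a bound $m\in\mathbb N$ and amplitudes $\delta(q,\sigma,p,c,\omega)\in\mathbb C$ for $q,p\in Q$, $\sigma\in\Sigma\cup\{\vdash,\dashv\}$, $c\in\{-m,\dots,m\}^k$, $\omega\in\Omega$ (and amplitude $0$ for all other $c\in\mathbb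 Z^k$). Let $E_{\sigma,\omega}$ be the matrix indexed by the configurations $Q\times\mathbb Z^k$ whose entry from $(q,v)$ to $(p,u)$ is $\delta(q,\sigma,p,u-v,\omega)$; the machine has to be well-formed: $\sum_{\omega}E_{\sigma,\omega}^\dagger E_{\sigma,\omega}=I$ for every $\sigma$. It reads one symbol $\sigma$ of $\vdash w\dashv$ per step, applying the operation $\rho\mapsto\sum_\omega E_{\sigma,\omega}\,\rho\,E_{\sigma,\omega}^\dagger$ and starting in the configuration $(q_0,0)$. Its acceptance probability $f(w)$ is the probability that a measurement after the last symbol finds a configuration $(q,0)$ with $q\in Q_a$. It recognizes $L\subseteq\Sigma^*$ with error bound $\varepsilon$ if $f(w)\ge 1-\varepsilon$ for $w\in L$ and $f(w)\le\varepsilon$ for $w\in\Sigma^*\setminus L$. Then the class of languages recognized by 1D$k$BCAs is a proper subset of the class of languages recognized by rtQ$k$BCAs with error bound $\varepsilon$. -/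

import Mathlib

/-- A formal language together with its finite input alphabet. -/
structure FormalLanguage where
  Alphabet : Type
  finiteAlphabet : Finite Alphabet
  words : Language Alphabet

/-- Tape symbols: the input letters and the two end-markers. -/
inductive TapeSymbol (α : Type) where
  | leftEnd : TapeSymbol α
  | letter : α → TapeSymbol α
  | rightEnd : TapeSymbol α

/-- The tape content for the input `w`: `w` between the two end-markers. -/
def tapeOf {α : Type} (w : List α) : List (TapeSymbol α) :=
  TapeSymbol.leftEnd :: (w.map TapeSymbol.letter ++ [TapeSymbol.rightEnd])

/-- Moves of a one-way head. -/
inductive HeadMove where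
  | stay : HeadMove
  | right : HeadMove

/-- One-way deterministic automata with `k` blind counters. The transition depends on the state and
the scanned symbol only, never on the counters. As the table is finite, the counter updates of a
machine lie in `{-m, …, m}` for some `m`. -/
structure OneWayDBCA (k : ℕ) (α : Type) where
  State : Type
  finiteState : Finite State
  init : State
  accept : Set State
  trans : State → TapeSymbol α → State × HeadMove × (Fin k → ℤ)

namespace OneWayDBCA

variable {k : ℕ} {α : Type}

/-- A configuration: the state, the part of the tape from the scanned square on, the counters. -/
structure Config (M : OneWayDBCA k α) where
  state : M.State
  rest : List (TapeSymbol α)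
  counters : Fin k → ℤ

/-- One step. The computation ends when the head has moved past the right end-marker, so such a
configuration is left unchanged. -/
def step (M : OneWayDBCA k α) : M.Config → M.Config
  | ⟨q, [], v⟩ => ⟨q, [], v⟩
  | ⟨q, s :: t, v⟩ =>
    match M.trans q s with
    | (p, HeadMove.stay, c) => ⟨p, s :: t, v + c⟩
    | (p, HeadMove.right, c) => ⟨p, t, v + c⟩

/-- The computation on `w` ends, in an accepting state and with all counters zero. -/
def Accepts (M : OneWayDBCA k α) (w : List α) : Prop :=
  ∃ n : ℕ, ∃ q ∈ M.accept, M.step^[n] ⟨M.init, tapeOf w, 0⟩ = ⟨q, [], 0⟩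

def Recognizes (M : OneWayDBCA k α) (L : Language α) : Prop :=
  ∀ w : List α, w ∈ L ↔ M.Accepts w

end OneWayDBCA

/-- Realtime quantum automata with `k` blind counters (data). `amp q s p c ω` is the amplitude with
which the machine, in state `q` and reading `s`, enters state `p`, adds `c` to the counters, and
writes `ω` on the finite register, which was reset to its initial symbol before the step.
The counter updates are restricted to `{-m, …, m}` in each component. -/
structure RealtimeQBCA (k : ℕ) (α : Type) where
  State : Type
  fintypeState : Fintype State
  Register : Type
  fintypeRegister : Fintype Register
  init : State
  accept : Finset State
  m : ℕ
  amp : State → TapeSymbol α → State → (Fin k → ℤ) → Register → ℂ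
  amp_eq_zero : ∀ q s p c ω, (∃ i, (m : ℤ) < |c i|) → amp q s p c ω = 0

namespace RealtimeQBCA

variable {k : ℕ} {α : Type}

instance (M : RealtimeQBCA k α) : Fintype M.State := M.fintypeState

instance (M : RealtimeQBCA k α) : Fintype M.Register := M.fintypeRegister

/-- A configuration: the state and the counter values. -/
abbrev Config (M : RealtimeQBCA k α) : Type := M.State × (Fin k → ℤ)

/-- `M.E s ω y x` is the amplitude of the transition from configuration `x` to configuration `y`
when `s` is read and `ω` is written on the register. -/
def E (M : RealtimeQBCA k α) (s : TapeSymbol α) (ω : M.Register) : Matrix M.Config M.Config ℂ :=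
  fun y x => M.amp x.1 s y.1 (y.2 - x.2) ω

/-- Each row and each column of `M.E s ω` has finitely many nonzero entries, so that the finite-support
sums below have their proper values. -/
theorem finite_near (M : RealtimeQBCA k α) (x : M.Config) :
    {y : M.Config | ∀ i, |y.2 i - x.2 i| ≤ (M.m : ℤ)}.Finite := by
  have h : {v : Fin k → ℤ | ∀ i, |v i - x.2 i| ≤ (M.m : ℤ)}.Finite := by
    refine (Set.Finite.pi' (fun i => Set.finite_Icc (x.2 i - M.m) (x.2 i + M.m))).subset ?_
    intro v hv i
    have := abs_le.1 (hv i)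
    constructor <;> linarith [this.1, this.2]
  refine (Set.finite_univ.prod h).subset ?_
  intro y hy
  exact ⟨Set.mem_univ _, hy⟩

theorem finite_column (M : RealtimeQBCA k α) (s : TapeSymbol α) (ω : M.Register) (x : M.Config) :
    {y | M.E s ω y x ≠ 0}.Finite := by
  refine (M.finite_near x).subset fun y hy i => ?_
  by_contra h
  exact hy (M.amp_eq_zero _ _ _ _ _ ⟨i, not_le.1 h⟩)

theorem finite_row (M : RealtimeQBCA k α) (s : TapeSymbol α) (ω : M.Register) (y : M.Config) :
    {x | M.E s ω y x ≠ 0}.Finite := by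
  refine (M.finite_near y).subset fun x hx i => ?_
  by_contra h
  rw [abs_sub_comm] at h
  exact hx (M.amp_eq_zero _ _ _ _ _ ⟨i, not_le.1 h⟩)

open Classical in
/-- For every tape symbol the operators `M.E s ω` satisfy `∑ ω, (E s ω)† (E s ω) = I`. -/
def WellFormed (M : RealtimeQBCA k α) : Prop :=
  ∀ (s : TapeSymbol α) (x x' : M.Config),
    ∑ ω : M.Register, ∑ᶠ y : M.Config, star (M.E s ω y x) * M.E s ω y x'
      = if x = x' then 1 else 0

/-- The (unnormalized) superposition obtained from `ψ` when `s` is read and the register shows `ω`. -/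
noncomputable def apply (M : RealtimeQBCA k α) (s : TapeSymbol α) (ω : M.Register)
    (ψ : M.Config → ℂ) : M.Config → ℂ :=
  fun y => ∑ᶠ x : M.Config, M.E s ω y x * ψ x

/-- The probability that, started in the (unnormalized) superposition `ψ` and after reading the given
symbols, the final measurement finds an accepting state and all counters zero. Discarding the register
after a step means summing over its contents. -/
noncomputable def probFrom (M : RealtimeQBCA k α) :
    List (TapeSymbol α) → (M.Config → ℂ) → ℝ
  | [], ψ => ∑ q ∈ M.accept, ‖ψ (q, 0)‖ ^ 2
  | s :: t, ψ => ∑ ω : M.Register, M.probFrom t (M.apply s ω ψ)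

open Classical in
/-- The acceptance probability of `M` on `w`. -/
noncomputable def acceptProb (M : RealtimeQBCA k α) (w : List α) : ℝ :=
  M.probFrom (tapeOf w) (Pi.single (M.init, 0) 1)

def RecognizesWithError (M : RealtimeQBCA k α) (ε : ℝ) (L : Language α) : Prop :=
  ∀ w : List α, (w ∈ L → 1 - ε ≤ M.acceptProb w) ∧ (w ∉ L → M.acceptProb w ≤ ε)

end RealtimeQBCA

/-- The class of languages recognized by one-way deterministic `k`-blind-counter automata. -/
def oneWayDBCALanguages (k : ℕ) : Set FormalLanguage :=
  {L | ∃ M : OneWayDBCA k L.Alphabet, M.Recognizes L.words}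

/-- The class of languages recognized by realtime quantum `k`-blind-counter automata with error
bound `ε`. -/
def realtimeQBCALanguages (k : ℕ) (ε : ℝ) : Set FormalLanguage :=
  {L | ∃ M : RealtimeQBCA k L.Alphabet, M.WellFormed ∧ M.RecognizesWithError ε L.words}

/-! Inclusion: a one-way machine that ever leaves a square does so in a state and with a counter
change fixed by the entry state and the symbol. Collapsing each such visit into one step gives a
realtime deterministic machine (`accepts_iff`), a special case of a probabilistic one. A
probabilistic machine is simulated quantumly with amplitudes `√prob` while the register records the
state being left, so branches never interfere and acceptance probabilities agree
(`exists_realtimeQBCA`).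

Properness: the separating language is `balancedWords (k + 1)`. With `k` blind counters, only `O(N ^
k)` configurations are reachable after prefixes of length `O(N)`, yet `N ^ (k + 1)` count vectors
must be told apart (`not_recognizes_balancedWords`). A randomized machine needs just one counter: it
evaluates the polynomial of count differences, of degree at most `k`, at a random `x < N`. Unless
the polynomial is zero, it has at most `k` roots, so the error is at most `k / N`
(`exists_recognizesWithError_balancedWords`). -/

namespace TapeSymbol

variable {α : Type}

instance [Finite α] : Finite (TapeSymbol α) := by
  let f : TapeSymbol α → Option (Option α)
    | leftEnd => none
    | rightEnd => some none
    | letter a => some (some a)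
  refine Finite.of_injective f fun a b h => ?_
  cases a <;> cases b <;> simp_all [f]

end TapeSymbol

/-! ### Realtime runs and the growth of counters -/

/-- The configuration that a total realtime transition function `δ` reaches on a tape. -/
def realtimeRun {S A : Type} {k : ℕ} (δ : S → A → S × (Fin k → ℤ)) (l : List A)
    (c : S × (Fin k → ℤ)) : S × (Fin k → ℤ) :=
  l.foldl (fun c s => ((δ c.1 s).1, c.2 + (δ c.1 s).2)) c

section RealtimeRun

variable {S A : Type} {k : ℕ} (δ : S → A → S × (Fin k → ℤ))

@[simp] theorem realtimeRun_nil (c : S × (Fin k → ℤ)) : realtimeRun δ [] c = c := rfl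

@[simp] theorem realtimeRun_cons (s : A) (l : List A) (c : S × (Fin k → ℤ)) :
    realtimeRun δ (s :: l) c = realtimeRun δ l ((δ c.1 s).1, c.2 + (δ c.1 s).2) := rfl

theorem realtimeRun_append (l l' : List A) (c : S × (Fin k → ℤ)) :
    realtimeRun δ (l ++ l') c = realtimeRun δ l' (realtimeRun δ l c) :=
  List.foldl_append

theorem exists_update_bound {T : Type} [Finite T] (f : T → Fin k → ℤ) :
    ∃ m : ℕ, ∀ t i, |f t i| ≤ (m : ℤ) := by
  obtain ⟨m, hm⟩ := (Set.finite_range fun p : T × Fin k => (f p.1 p.2).natAbs).bddAbove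
  refine ⟨m, fun t i => ?_⟩
  rw [Int.abs_eq_natAbs]
  exact_mod_cast hm ⟨(t, i), rfl⟩

theorem abs_realtimeRun_le {m : ℕ} (hm : ∀ q s i, |(δ q s).2 i| ≤ (m : ℤ)) (l : List A)
    (c : S × (Fin k → ℤ)) (i : Fin k) :
    |(realtimeRun δ l c).2 i| ≤ |c.2 i| + m * l.length := by
  induction l generalizing c with
  | nil => simp
  | cons s l ih =>
    have h := ih ((δ c.1 s).1, c.2 + (δ c.1 s).2)
    have h' := abs_add_le (c.2 i) ((δ c.1 s).2 i)
    have h'' := hm c.1 s i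
    simp only [realtimeRun_cons, List.length_cons, Pi.add_apply] at h ⊢
    push_cast
    linarith

end RealtimeRun

/-! ### Eliminating stationary head moves -/

namespace OneWayDBCA

variable {k : ℕ} {α : Type} (M : OneWayDBCA k α)

/-- `M.Crosses s q p c`: entering a square with symbol `s` in state `q`, the machine leaves it in
state `p`, having added `c` to the counters. -/
inductive Crosses (s : TapeSymbol α) : M.State → M.State → (Fin k → ℤ) → Prop
  | right {q p c} : M.trans q s = (p, HeadMove.right, c) → Crosses s q p c
  | stay {q r p c d} : M.trans q s = (r, HeadMove.stay, c) → Crosses s r p d →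
      Crosses s q p (c + d)

variable {M}

theorem step_of_stay {q r : M.State} {s : TapeSymbol α} {c : Fin k → ℤ}
    (h : M.trans q s = (r, HeadMove.stay, c)) (t : List (TapeSymbol α)) (v : Fin k → ℤ) :
    M.step ⟨q, s :: t, v⟩ = ⟨r, s :: t, v + c⟩ := by
  simp [step, h]

theorem step_of_right {q r : M.State} {s : TapeSymbol α} {c : Fin k → ℤ}
    (h : M.trans q s = (r, HeadMove.right, c)) (t : List (TapeSymbol α)) (v : Fin k → ℤ) :
    M.step ⟨q, s :: t, v⟩ = ⟨r, t, v + c⟩ := by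
  simp [step, h]

theorem iterate_step_nil (n : ℕ) (q : M.State) (v : Fin k → ℤ) :
    M.step^[n] ⟨q, [], v⟩ = ⟨q, [], v⟩ :=
  Function.iterate_fixed rfl n

/-- Determinism makes the outcome of a crossing unique, so the choice in `crossTrans` is no choice
at all. -/
theorem Crosses.unique {s : TapeSymbol α} {q p p' : M.State} {c c' : Fin k → ℤ}
    (h : M.Crosses s q p c) (h' : M.Crosses s q p' c') : p = p' ∧ c = c' := by
  induction h generalizing c' with
  | right h =>
    cases h' with
    | right g => simp_all
    | stay g _ => simp_all
  | stay h _ ih =>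
    cases h' with
    | right g => simp_all
    | stay g g' =>
      rw [h] at g
      cases g
      obtain ⟨rfl, rfl⟩ := ih g'
      exact ⟨rfl, rfl⟩

theorem Crosses.exists_iterate {s : TapeSymbol α} {q p : M.State} {c : Fin k → ℤ}
    (h : M.Crosses s q p c) (t : List (TapeSymbol α)) (v : Fin k → ℤ) :
    ∃ n, M.step^[n] ⟨q, s :: t, v⟩ = ⟨p, t, v + c⟩ := by
  induction h generalizing v with
  | right h => exact ⟨1, step_of_right h t v⟩
  | @stay q r p c d h _ ih =>
    obtain ⟨n, hn⟩ := ih (v + c)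
    exact ⟨n + 1, by rw [Function.iterate_succ_apply, step_of_stay h, hn, add_assoc]⟩

theorem exists_crosses_of_iterate {s : TapeSymbol α} {t : List (TapeSymbol α)} {r : M.State}
    {u : Fin k → ℤ} (n : ℕ) {q : M.State} {v : Fin k → ℤ}
    (h : M.step^[n] ⟨q, s :: t, v⟩ = ⟨r, [], u⟩) :
    ∃ p c, M.Crosses s q p c ∧ ∃ n', M.step^[n'] ⟨p, t, v + c⟩ = ⟨r, [], u⟩ := by
  induction n generalizing q v with
  | zero => simp at h
  | succ n ih =>
    rw [Function.iterate_succ_apply] at h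
    rcases e : M.trans q s with ⟨p, _ | _, c⟩
    · rw [step_of_stay e] at h
      obtain ⟨p', d, hc, n', hn'⟩ := ih h
      exact ⟨p', c + d, .stay e hc, n', by rw [← add_assoc, hn']⟩
    · rw [step_of_right e] at h
      exact ⟨p, c, .right e, n, h⟩

variable (M)

open Classical in
/-- The transition function that crosses a whole square in one step; `none` is a dead state for the
computations that stay on a square forever. -/
noncomputable def crossTrans :
    Option M.State → TapeSymbol α → Option M.State × (Fin k → ℤ)
  | none, _ => (none, 0)
  | some q, s =>
    if h : ∃ x : M.State × (Fin k → ℤ), M.Crosses s q x.1 x.2 then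
      (some h.choose.1, h.choose.2) else (none, 0)

variable {M}

theorem Crosses.crossTrans_eq {s : TapeSymbol α} {q p : M.State} {c : Fin k → ℤ}
    (h : M.Crosses s q p c) : M.crossTrans (some q) s = (some p, c) := by
  have hx : ∃ x : M.State × (Fin k → ℤ), M.Crosses s q x.1 x.2 := ⟨(p, c), h⟩
  obtain ⟨h₁, h₂⟩ := hx.choose_spec.unique h
  rw [crossTrans, dif_pos hx, h₁, h₂]

theorem crossTrans_eq_none {s : TapeSymbol α} {q : M.State}
    (h : ¬ ∃ x : M.State × (Fin k → ℤ), M.Crosses s q x.1 x.2) :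
    M.crossTrans (some q) s = (none, 0) := by
  rw [crossTrans, dif_neg h]

theorem realtimeRun_crossTrans_none (l : List (TapeSymbol α)) (v : Fin k → ℤ) :
    realtimeRun M.crossTrans l (none, v) = (none, v) := by
  induction l with
  | nil => rfl
  | cons s l ih => simpa [crossTrans] using ih

/-- A computation that empties the tape splits into one crossing per square. If some square is never
left, the realtime run is trapped in `none` and cannot end in `some r`. -/
theorem exists_iterate_iff (l : List (TapeSymbol α)) (q r : M.State) (v u : Fin k → ℤ) :
    (∃ n, M.step^[n] ⟨q, l, v⟩ = ⟨r, [], u⟩) ↔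
      realtimeRun M.crossTrans l (some q, v) = (some r, u) := by
  induction l generalizing q v with
  | nil => simp [iterate_step_nil]
  | cons s t ih =>
    constructor
    · rintro ⟨n, hn⟩
      obtain ⟨p, c, hc, hn'⟩ := exists_crosses_of_iterate n hn
      rw [realtimeRun_cons, hc.crossTrans_eq]
      exact (ih p (v + c)).1 hn'
    · intro h
      by_cases hx : ∃ x : M.State × (Fin k → ℤ), M.Crosses s q x.1 x.2
      · obtain ⟨⟨p, c⟩, hc⟩ := hx
        rw [realtimeRun_cons, hc.crossTrans_eq] at h
        obtain ⟨n, hn⟩ := (ih p (v + c)).2 h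
        obtain ⟨n', hn'⟩ := hc.exists_iterate t v
        exact ⟨n + n', by rw [Function.iterate_add_apply, hn', hn]⟩
      · rw [realtimeRun_cons, crossTrans_eq_none hx, realtimeRun_crossTrans_none] at h
        simp at h

theorem accepts_iff (w : List α) :
    M.Accepts w ↔ (realtimeRun M.crossTrans (tapeOf w) (some M.init, 0)).1 ∈ some '' M.accept ∧
      (realtimeRun M.crossTrans (tapeOf w) (some M.init, 0)).2 = 0 := by
  constructor
  · rintro ⟨n, q, hq, h⟩
    rw [(exists_iterate_iff _ _ _ _ _).1 ⟨n, h⟩]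
    exact ⟨⟨q, hq, rfl⟩, rfl⟩
  · rintro ⟨⟨q, hq, h⟩, h'⟩
    obtain ⟨n, hn⟩ := (exists_iterate_iff _ _ _ _ _).2 (Prod.ext h.symm h')
    exact ⟨n, q, hq, hn⟩

end OneWayDBCA

/-! ### Probabilistic automata and their quantum simulation -/

/-- Realtime probabilistic automata with `k` blind counters; the counter update of a transition is
determined by its two states and the scanned symbol. -/
structure RealtimePBCA (k : ℕ) (α : Type) where
  State : Type
  fintypeState : Fintype State
  init : State
  accept : Finset State
  prob : State → TapeSymbol α → State → ℝ
  prob_nonneg : ∀ q s p, 0 ≤ prob q s p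
  update : State → TapeSymbol α → State → Fin k → ℤ

namespace RealtimePBCA

variable {k : ℕ} {α : Type}

instance (P : RealtimePBCA k α) : Fintype P.State := P.fintypeState

variable (P : RealtimePBCA k α)

open Classical in
/-- The probability of acceptance from state `q` with counters `v`. -/
noncomputable def probFrom : List (TapeSymbol α) → P.State → (Fin k → ℤ) → ℝ
  | [], q, v => if q ∈ P.accept ∧ v = 0 then 1 else 0
  | s :: t, q, v => ∑ p, P.prob q s p * probFrom t p (v + P.update q s p)

open Classical in
/-- The quantum automaton that simulates `P`, writing the state it leaves on the register. -/
noncomputable def toQuantum (m : ℕ) (hm : ∀ q s p i, |P.update q s p i| ≤ (m : ℤ)) :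
    RealtimeQBCA k α where
  State := P.State
  fintypeState := P.fintypeState
  Register := P.State
  fintypeRegister := P.fintypeState
  init := P.init
  accept := P.accept
  m := m
  amp q s p c ω := if ω = q ∧ c = P.update q s p then (√(P.prob q s p) : ℂ) else 0
  amp_eq_zero := by
    rintro q s p c ω ⟨i, hi⟩
    rw [if_neg]
    rintro ⟨-, rfl⟩
    exact absurd hi (not_lt.2 (hm q s p i))

variable {P}

theorem probFrom_cons_of_prob_eq_one {s : TapeSymbol α} {q r : P.State}
    (h : P.prob q s r = 1) (h' : ∀ p, p ≠ r → P.prob q s p = 0) (t : List (TapeSymbol α))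
    (v : Fin k → ℤ) : P.probFrom (s :: t) q v = P.probFrom t r (v + P.update q s r) := by
  rw [probFrom, Finset.sum_eq_single r, h, one_mul]
  · intro p _ hp
    rw [h' p hp, zero_mul]
  · simp

variable {m : ℕ} {hm : ∀ q s p i, |P.update q s p i| ≤ (m : ℤ)}

variable (P) in
open Classical in
/-- The amplitude from configuration `x` to configuration `y` in the simulating quantum automaton. -/
noncomputable def configAmp (s : TapeSymbol α) (ω : P.State) (y x : P.State × (Fin k → ℤ)) : ℂ :=
  if ω = x.1 ∧ y.2 - x.2 = P.update x.1 s y.1 then (√(P.prob x.1 s y.1) : ℂ) else 0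

open Classical in
-- Columns have norm one because the squared amplitudes are the transition probabilities. They are
-- orthogonal because the register reveals the source state, and source state, symbol and target
-- state determine the update, hence the old counters.
theorem sum_star_configAmp_mul (hsum : ∀ q s, ∑ p, P.prob q s p = 1) (s : TapeSymbol α)
    (x x' : P.State × (Fin k → ℤ)) :
    ∑ ω : P.State, ∑ᶠ y : P.State × (Fin k → ℤ),
      star (P.configAmp s ω y x) * P.configAmp s ω y x' = if x = x' then 1 else 0 := by
  by_cases hx : x = x'
  · subst hx
    rw [if_pos rfl, Finset.sum_eq_single x.1]
    · let e : P.State ↪ P.State × (Fin k → ℤ) :=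
        ⟨fun p => (p, x.2 + P.update x.1 s p), fun a b h => (Prod.ext_iff.1 h).1⟩
      have he (p : P.State) : e p = (p, x.2 + P.update x.1 s p) := rfl
      rw [finsum_eq_sum_of_support_subset (s := Finset.univ.map e), Finset.sum_map]
      · rw [← Complex.ofReal_one, ← hsum x.1 s, Complex.ofReal_sum]
        refine Finset.sum_congr rfl fun p _ => ?_
        rw [configAmp, he, if_pos ⟨rfl, by simp⟩]
        simp only [Complex.star_def, Complex.conj_ofReal]
        rw [← Complex.ofReal_mul, Real.mul_self_sqrt (P.prob_nonneg _ _ _)]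
      · intro y hy
        have hy' : P.configAmp s x.1 y x ≠ 0 := right_ne_zero_of_mul hy
        rw [configAmp] at hy'
        have h := (ite_ne_right_iff.1 hy').1.2
        simp only [Finset.coe_map, Finset.coe_univ, Set.image_univ, Set.mem_range]
        exact ⟨y.1, Prod.ext rfl (by rw [he, ← h, add_sub_cancel])⟩
    · intro ω _ hω
      refine finsum_eq_zero_of_forall_eq_zero fun y => ?_
      rw [configAmp, if_neg fun h => hω h.1, mul_zero]
    · simp
  · rw [if_neg hx]
    refine Finset.sum_eq_zero fun ω _ => finsum_eq_zero_of_forall_eq_zero fun y => ?_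
    by_contra h
    have h₁ := left_ne_zero_of_mul h
    have h₂ := right_ne_zero_of_mul h
    rw [star_ne_zero, configAmp] at h₁
    rw [configAmp] at h₂
    obtain ⟨⟨h₁, h₁'⟩, -⟩ := ite_ne_right_iff.1 h₁
    obtain ⟨⟨h₂, h₂'⟩, -⟩ := ite_ne_right_iff.1 h₂
    have h₃ : x.1 = x'.1 := h₁.symm.trans h₂
    refine hx (Prod.ext h₃ ?_)
    rw [← h₃, ← h₁'] at h₂'
    exact (sub_right_injective h₂').symm

theorem toQuantum_wellFormed (hsum : ∀ q s, ∑ p, P.prob q s p = 1) :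
    (P.toQuantum m hm).WellFormed := fun s x x' =>
  (sum_star_configAmp_mul hsum s x x').trans (by congr)

open Classical in
/-- The superposition in which state `q` has amplitude `a q` and counter values `g q`. -/
noncomputable def superposition (a : P.State → ℂ) (g : P.State → Fin k → ℤ) :
    P.State × (Fin k → ℤ) → ℂ :=
  fun x => if x.2 = g x.1 then a x.1 else 0

/-- Register content `ω` selects the branch that left state `ω`, so again each state carries a
single counter vector; this is what keeps the induction in `toQuantum_probFrom` going. -/
theorem toQuantum_apply (s : TapeSymbol α) (ω : P.State) (a : P.State → ℂ)
    (g : P.State → Fin k → ℤ) :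
    (P.toQuantum m hm).apply s ω (superposition a g) =
      superposition (fun p => √(P.prob ω s p) * a ω) (fun p => g ω + P.update ω s p) := by
  classical
  funext (y : P.State × (Fin k → ℤ))
  change ∑ᶠ x : P.State × (Fin k → ℤ), P.configAmp s ω y x * superposition a g x = _
  rw [finsum_eq_single _ (ω, g ω)]
  · rw [configAmp, superposition, superposition]
    by_cases h : y.2 = g ω + P.update ω s y.1
    · simp [h]
    · rw [if_neg h, if_neg, zero_mul]
      rintro ⟨-, h'⟩
      exact h (sub_eq_iff_eq_add'.1 h')
  · intro x hx
    by_contra h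
    have h₁ := left_ne_zero_of_mul h
    have h₂ := right_ne_zero_of_mul h
    rw [configAmp] at h₁
    rw [superposition] at h₂
    obtain ⟨⟨rfl, -⟩, -⟩ := ite_ne_right_iff.1 h₁
    exact hx (Prod.ext rfl (ite_ne_right_iff.1 h₂).1)

theorem toQuantum_probFrom (t : List (TapeSymbol α)) (a : P.State → ℂ)
    (g : P.State → Fin k → ℤ) :
    (P.toQuantum m hm).probFrom t (superposition a g) =
      ∑ q, ‖a q‖ ^ 2 * P.probFrom t q (g q) := by
  classical
  induction t generalizing a g with
  | nil =>
    change ∑ q ∈ P.accept, ‖superposition a g (q, 0)‖ ^ 2 = _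
    rw [← Finset.sum_filter_of_ne (s := Finset.univ) (p := (· ∈ P.accept))]
    · rw [Finset.filter_univ_mem]
      refine Finset.sum_congr rfl fun q hq => ?_
      by_cases h : g q = 0
      · simp [superposition, probFrom, hq, h]
      · simp [superposition, probFrom, h, Ne.symm h]
    · intro q _ h
      exact (ite_ne_right_iff.1 (right_ne_zero_of_mul h)).1.1
  | cons s t ih =>
    change ∑ ω : P.State, (P.toQuantum m hm).probFrom t
      ((P.toQuantum m hm).apply s ω (superposition a g)) = _
    refine Finset.sum_congr rfl fun ω _ => ?_
    rw [toQuantum_apply, ih, probFrom, Finset.mul_sum]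
    refine Finset.sum_congr rfl fun p _ => ?_
    rw [norm_mul, mul_pow, Complex.norm_real, Real.norm_eq_abs, sq_abs,
      Real.sq_sqrt (P.prob_nonneg _ _ _)]
    ring

theorem toQuantum_acceptProb (w : List α) :
    (P.toQuantum m hm).acceptProb w = P.probFrom (tapeOf w) P.init 0 := by
  classical
  have h : (Pi.single (P.init, 0) 1 : P.State × (Fin k → ℤ) → ℂ) =
      superposition (Pi.single P.init 1) (fun _ => 0) := by
    funext x
    obtain ⟨q, v⟩ := x
    by_cases hv : v = 0 <;> by_cases hq : q = P.init <;>
      simp [superposition, hv, hq]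
  have h' := toQuantum_probFrom (m := m) (hm := hm) (tapeOf w) (Pi.single P.init 1) (fun _ => 0)
  rw [← h] at h'
  refine Eq.trans ?_ (h'.trans ?_)
  · unfold RealtimeQBCA.acceptProb
    congr!
  · rw [Finset.sum_eq_single P.init]
    · simp
    · intro q _ hq
      simp [hq]
    · simp

theorem exists_realtimeQBCA [Finite α] (hsum : ∀ q s, ∑ p, P.prob q s p = 1) :
    ∃ M : RealtimeQBCA k α, M.WellFormed ∧
      ∀ w, M.acceptProb w = P.probFrom (tapeOf w) P.init 0 := by
  obtain ⟨m, hm⟩ := exists_update_bound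
    fun x : P.State × TapeSymbol α × P.State => P.update x.1 x.2.1 x.2.2
  exact ⟨P.toQuantum m fun q s p => hm (q, s, p), toQuantum_wellFormed hsum,
    toQuantum_acceptProb⟩

open Classical in
/-- A deterministic realtime transition function as a probabilistic automaton. -/
noncomputable def ofDeterministic {S : Type} [Fintype S] (init : S) (accept : Finset S)
    (δ : S → TapeSymbol α → S × (Fin k → ℤ)) : RealtimePBCA k α where
  State := S
  fintypeState := inferInstance
  init := init
  accept := accept
  prob q s p := if p = (δ q s).1 then 1 else 0
  prob_nonneg q s p := by split_ifs <;> norm_num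
  update q s _ := (δ q s).2

theorem sum_ofDeterministic_prob {S : Type} [Fintype S] (init : S) (accept : Finset S)
    (δ : S → TapeSymbol α → S × (Fin k → ℤ)) (q : S) (s : TapeSymbol α) :
    ∑ p : S, (ofDeterministic init accept δ).prob q s p = 1 := by
  classical
  refine (Finset.sum_eq_single (δ q s).1 (fun p _ h => if_neg h) (by simp)).trans (if_pos rfl)

open Classical in
theorem ofDeterministic_probFrom {S : Type} [Fintype S] (init : S) (accept : Finset S)
    (δ : S → TapeSymbol α → S × (Fin k → ℤ)) (t : List (TapeSymbol α)) (q : S) (v : Fin k → ℤ) :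
    (ofDeterministic init accept δ).probFrom t q v =
      if (realtimeRun δ t (q, v)).1 ∈ accept ∧ (realtimeRun δ t (q, v)).2 = 0 then 1 else 0 := by
  induction t generalizing q v with
  | nil => rfl
  | cons s t ih =>
    rw [realtimeRun_cons, ← ih]
    exact probFrom_cons_of_prob_eq_one (P := ofDeterministic init accept δ)
      (if_pos rfl) (fun _ h => if_neg h) t v

end RealtimePBCA

theorem oneWayDBCALanguages_subset (k : ℕ) {ε : ℝ} (hε : 0 < ε) :
    oneWayDBCALanguages k ⊆ realtimeQBCALanguages k ε := by
  classical
  rintro L ⟨M, hM⟩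
  have := L.finiteAlphabet
  have := M.finiteState
  have := Fintype.ofFinite M.State
  let P : RealtimePBCA k L.Alphabet :=
    .ofDeterministic (some M.init) (Set.toFinset (some '' M.accept)) M.crossTrans
  obtain ⟨A, hA, hprob⟩ := RealtimePBCA.exists_realtimeQBCA (P := P)
    (RealtimePBCA.sum_ofDeterministic_prob _ _ M.crossTrans)
  refine ⟨A, hA, fun w => ?_⟩
  have hw : A.acceptProb w = if M.Accepts w then 1 else 0 := by
    rw [hprob, M.accepts_iff]
    refine (RealtimePBCA.ofDeterministic_probFrom _ _ _ _ _ _).trans ?_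
    simp only [Set.mem_toFinset]
    congr
  rw [hw, hM w]
  constructor <;> intro h <;> simp [h, hε.le]

/-! ### The separating language -/

/-- The words over `Fin n × Bool` in which `(i, true)` and `(i, false)` occur equally often, for
every `i`. -/
def balancedWords (n : ℕ) : Language (Fin n × Bool) :=
  {w | ∀ i, w.count (i, true) = w.count (i, false)}

theorem mem_balancedWords {n : ℕ} {w : List (Fin n × Bool)} :
    w ∈ balancedWords n ↔ ∀ i, w.count (i, true) = w.count (i, false) := Iff.rfl

/-! ### Counting configurations of deterministic machines -/

section LowerBound

/-- The word in which the letter `(i, b)` occurs `f i` times. -/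
def blockWord {n : ℕ} (f : Fin n → ℕ) (b : Bool) : List (Fin n × Bool) :=
  (List.finRange n).flatMap fun i => List.replicate (f i) (i, b)

theorem count_blockWord {n : ℕ} (f : Fin n → ℕ) (b b' : Bool) (i : Fin n) :
    (blockWord f b).count (i, b') = if b = b' then f i else 0 := by
  rw [blockWord, List.count_flatMap, ← Fin.sum_univ_def]
  simp only [Function.comp_apply, List.count_replicate, beq_iff_eq, Prod.mk.injEq]
  by_cases h : b = b' <;> simp [h]

theorem length_blockWord_le {n N : ℕ} (f : Fin n → ℕ) (hf : ∀ i, f i ≤ N) (b : Bool) :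
    (blockWord f b).length ≤ n * N := by
  rw [blockWord, List.length_flatMap, ← Fin.sum_univ_def]
  simpa using Finset.sum_le_card_nsmul Finset.univ f N fun i _ => hf i

theorem blockWord_append_mem_balancedWords {n : ℕ} (f g : Fin n → ℕ) :
    blockWord f true ++ blockWord g false ∈ balancedWords n ↔ f = g := by
  rw [mem_balancedWords, funext_iff]
  simp [List.count_append, count_blockWord]

theorem not_recognizes_balancedWords (k : ℕ) (M : OneWayDBCA k (Fin (k + 1) × Bool)) :
    ¬ M.Recognizes (balancedWords (k + 1)) := by
  classical
  intro hM
  have := M.finiteState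
  have := Fintype.ofFinite M.State
  let δ := M.crossTrans
  obtain ⟨m, hm⟩ := exists_update_bound
    fun x : Option M.State × TapeSymbol (Fin (k + 1) × Bool) => (δ x.1 x.2).2
  -- A prefix, with its end-marker, has at most `(k + 1) * N + 1 ≤ (k + 2) * N` symbols, so counters
  -- stay in `[-B, B]`, which has at most `D * N` integers. `N` exceeds `card * D ^ k`, hence `card
  -- * (D * N) ^ k < N ^ (k + 1)`.
  let D := 2 * (m * (k + 2)) + 1
  let N := Fintype.card (Option M.State) * D ^ k + 1
  let B : ℕ := m * (k + 2) * N
  let run (f : Fin (k + 1) → Fin N) : Option M.State × (Fin k → ℤ) :=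
    realtimeRun δ (.leftEnd :: (blockWord (fun i => (f i : ℕ)) true).map .letter) (some M.init, 0)
  let T : Finset (Option M.State × (Fin k → ℤ)) :=
    Finset.univ ×ˢ Fintype.piFinset fun _ => Finset.Icc (-(B : ℤ)) B
  have hT : T.card < (Finset.univ : Finset (Fin (k + 1) → Fin N)).card := by
    have hN : 1 ≤ N := Nat.le_add_left _ _
    have h₁ : T.card = Fintype.card (Option M.State) * (2 * B + 1) ^ k := by
      simp only [T, Finset.card_product, Finset.card_univ, Fintype.card_piFinset, Int.card_Icc,
        Finset.prod_const, Fintype.card_fin]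
      congr 2
      omega
    have h₂ : 2 * B + 1 ≤ D * N := by
      simp only [B, D]
      nlinarith
    rw [h₁, Finset.card_univ, Fintype.card_fun, Fintype.card_fin, Fintype.card_fin]
    calc Fintype.card (Option M.State) * (2 * B + 1) ^ k
        ≤ Fintype.card (Option M.State) * (D * N) ^ k := by gcongr
      _ = Fintype.card (Option M.State) * D ^ k * N ^ k := by rw [mul_pow, mul_assoc]
      _ < N * N ^ k := Nat.mul_lt_mul_of_pos_right (Nat.lt_succ_self _) (by positivity)
      _ = N ^ (k + 1) := by ring
  have hrun : Set.MapsTo run (Finset.univ : Finset (Fin (k + 1) → Fin N)) T := by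
    intro f _
    have hlen := length_blockWord_le (fun i => (f i : ℕ)) (fun i => (f i).2.le) true
    simp only [T, Finset.mem_coe, Finset.mem_product, Finset.mem_univ, true_and,
      Fintype.mem_piFinset, Finset.mem_Icc]
    intro i
    rw [← abs_le]
    refine (abs_realtimeRun_le δ (fun q s => hm (q, s)) _ _ i).trans ?_
    simp only [List.length_cons, List.length_map, Pi.zero_apply, abs_zero, zero_add, B]
    have : (blockWord (fun i => (f i : ℕ)) true).length + 1 ≤ (k + 2) * N := by
      have hN : 1 ≤ N := Nat.le_add_left _ _
      linarith
    rw [mul_assoc]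
    exact_mod_cast Nat.mul_le_mul_left m this
  obtain ⟨f, -, g, -, hne, heq⟩ := Finset.exists_ne_map_eq_of_card_lt_of_maps_to hT hrun
  -- The prefixes of `f` and `g` lead to the same configuration; the suffix that balances `f` must
  -- then be accepted after `g` as well.
  have key (h : Fin (k + 1) → Fin N) :
      realtimeRun δ (tapeOf (blockWord (fun i => (h i : ℕ)) true ++
        blockWord (fun i => (f i : ℕ)) false)) (some M.init, 0) =
      realtimeRun δ ((blockWord (fun i => (f i : ℕ)) false).map .letter ++ [.rightEnd]) (run h) := by
    rw [← realtimeRun_append]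
    simp [tapeOf]
  have hf := (blockWord_append_mem_balancedWords (fun i => (f i : ℕ)) _).2 rfl
  have hg := (blockWord_append_mem_balancedWords (fun i => (g i : ℕ)) (fun i => (f i : ℕ))).not.2
    fun h => hne (funext fun i => Fin.ext (congrFun h i).symm)
  rw [hM, M.accepts_iff] at hf hg
  change ¬ ((realtimeRun δ _ _).1 ∈ _ ∧ (realtimeRun δ _ _).2 = 0) at hg
  rw [key, ← heq, ← key] at hg
  exact hg hf

end LowerBound

/-! ### Testing balance by random evaluation -/

section UpperBound

open Polynomial

/-- The update of the counters on a tape symbol by the weight `x ^ i` for `(i, true)` and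
`-x ^ i` for `(i, false)`. -/
def powerWeight {k n : ℕ} (x : ℤ) : TapeSymbol (Fin n × Bool) → Fin (k + 1) → ℤ
  | .letter (i, true) => Pi.single 0 (x ^ (i : ℕ))
  | .letter (i, false) => Pi.single 0 (-x ^ (i : ℕ))
  | _ => 0

/-- The polynomial whose coefficients are the differences of the letter counts. -/
noncomputable def imbalance {n : ℕ} (w : List (Fin n × Bool)) : ℤ[X] :=
  ∑ i : Fin n, C ((w.count (i, true) : ℤ) - w.count (i, false)) * X ^ (i : ℕ)

theorem imbalance_nil {n : ℕ} : imbalance ([] : List (Fin n × Bool)) = 0 := by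
  simp [imbalance]

theorem eval_imbalance_cons {n : ℕ} (x : ℤ) (i : Fin n) (b : Bool) (w : List (Fin n × Bool)) :
    (imbalance ((i, b) :: w)).eval x =
      (if b then x ^ (i : ℕ) else -x ^ (i : ℕ)) + (imbalance w).eval x := by
  simp only [imbalance, eval_finsetSum, eval_mul, eval_C, eval_pow, eval_X]
  rw [← sub_eq_iff_eq_add, ← Finset.sum_sub_distrib, Finset.sum_eq_single i]
  · cases b <;> simp <;> ring
  · intro j _ hj
    simp [hj.symm]
  · simp

theorem coeff_imbalance {n : ℕ} (w : List (Fin n × Bool)) (i : Fin n) :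
    (imbalance w).coeff i = (w.count (i, true) : ℤ) - w.count (i, false) := by
  simp only [imbalance, finsetSum_coeff, coeff_C_mul_X_pow, Fin.val_inj]
  simp

theorem imbalance_eq_zero_iff {n : ℕ} (w : List (Fin n × Bool)) :
    imbalance w = 0 ↔ w ∈ balancedWords n := by
  constructor
  · intro h i
    have := coeff_imbalance w i
    rw [h, coeff_zero] at this
    omega
  · intro h
    exact Finset.sum_eq_zero fun i _ => by simp [h i]

theorem natDegree_imbalance_le {k : ℕ} (w : List (Fin (k + 1) × Bool)) :
    (imbalance w).natDegree ≤ k :=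
  natDegree_sum_le_of_forall_le _ _ fun i _ =>
    (natDegree_C_mul_X_pow_le _ _).trans (Nat.lt_succ_iff.1 i.2)

/-- The bad choices of `x` are distinct integer roots of a nonzero polynomial of degree at most `k`.
-/
theorem card_eval_imbalance_eq_zero_le {k : ℕ} {w : List (Fin (k + 1) × Bool)}
    (hw : w ∉ balancedWords (k + 1)) (N : ℕ) :
    (Finset.univ.filter fun x : Fin N => (imbalance w).eval (x : ℤ) = 0).card ≤ k := by
  classical
  have h0 := (imbalance_eq_zero_iff w).not.2 hw
  refine le_trans ?_ ((card_roots' _).trans (natDegree_imbalance_le w))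
  refine le_trans ?_ (Multiset.toFinset_card_le _)
  refine Finset.card_le_card_of_injOn (fun x : Fin N => (x : ℤ)) ?_ ?_
  · intro x hx
    simpa [h0] using hx
  · intro x _ y _ h
    exact Fin.ext (Nat.cast_injective h)

open Classical in
/-- The probabilistic automaton that chooses `x < N` at random on the left end-marker and then adds
the weights `powerWeight x` to the counters. -/
noncomputable def balanceTester (k n N : ℕ) [NeZero N] :
    RealtimePBCA (k + 1) (Fin n × Bool) where
  State := Fin N
  fintypeState := inferInstance
  init := 0
  accept := Finset.univ
  prob q s p := match s with
    | .leftEnd => (N : ℝ)⁻¹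
    | _ => if p = q then 1 else 0
  prob_nonneg q s p := by
    cases s <;> simp only <;> positivity
  update q s _ := powerWeight (q : ℕ) s

theorem sum_balanceTester_prob (k n N : ℕ) [NeZero N] (q : Fin N)
    (s : TapeSymbol (Fin n × Bool)) : ∑ p : Fin N, (balanceTester k n N).prob q s p = 1 := by
  cases s <;> simp [balanceTester]

theorem balanceTester_probFrom_cons {k n N : ℕ} [NeZero N] {s : TapeSymbol (Fin n × Bool)}
    (hs : s ≠ .leftEnd) (t : List (TapeSymbol (Fin n × Bool))) (q : Fin N)
    (v : Fin (k + 1) → ℤ) :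
    (balanceTester k n N).probFrom (s :: t) q v =
      (balanceTester k n N).probFrom t q (v + powerWeight (q : ℕ) s) := by
  refine RealtimePBCA.probFrom_cons_of_prob_eq_one (P := balanceTester k n N) (r := q) ?_ ?_ t v
  · cases s with
    | leftEnd => exact absurd rfl hs
    | _ => exact if_pos rfl
  · intro p hp
    cases s with
    | leftEnd => exact absurd rfl hs
    | _ => exact if_neg hp

open Classical in
theorem balanceTester_probFrom_nil {k n N : ℕ} [NeZero N] (q : Fin N) (v : Fin (k + 1) → ℤ) :
    (balanceTester k n N).probFrom [] q v = if v = 0 then 1 else 0 := by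
  have hq : q ∈ (balanceTester k n N).accept := Finset.mem_univ q
  by_cases hv : v = 0
  · exact (if_pos ⟨hq, hv⟩).trans (if_pos hv).symm
  · exact (if_neg fun h => hv h.2).trans (if_neg hv).symm

open Classical in
-- After the left end-marker the state `q` is frozen and only counter `0` moves; reading `w` adds
-- the value of `imbalance w` at `q` to it.
theorem balanceTester_probFrom_letters {k n N : ℕ} [NeZero N] (w : List (Fin n × Bool))
    (q : Fin N) (z : ℤ) :
    (balanceTester k n N).probFrom (w.map .letter ++ [.rightEnd]) q (Pi.single 0 z) =
      if z + (imbalance w).eval ((q : ℕ) : ℤ) = 0 then 1 else 0 := by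
  induction w generalizing z with
  | nil =>
    rw [List.map_nil, List.nil_append, balanceTester_probFrom_cons (by simp),
      balanceTester_probFrom_nil]
    simp [imbalance_nil, powerWeight]
  | cons a w ih =>
    obtain ⟨i, b⟩ := a
    have hw : (powerWeight (q : ℕ) (.letter (i, b)) : Fin (k + 1) → ℤ) =
        Pi.single 0 (if b then ((q : ℕ) : ℤ) ^ (i : ℕ) else -((q : ℕ) : ℤ) ^ (i : ℕ)) := by
      cases b <;> rfl
    rw [List.map_cons, List.cons_append, balanceTester_probFrom_cons (by simp), hw, ← Pi.single_add, ih, eval_imbalance_cons, add_assoc]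

open Classical in
theorem balanceTester_probFrom_tapeOf {k n N : ℕ} [NeZero N] (w : List (Fin n × Bool)) :
    (balanceTester k n N).probFrom (tapeOf w) (0 : Fin N) 0 =
      (Finset.univ.filter fun x : Fin N => (imbalance w).eval (x : ℤ) = 0).card / N := by
  change ∑ p : Fin N, (N : ℝ)⁻¹ *
    (balanceTester k n N).probFrom (w.map .letter ++ [.rightEnd]) p (0 + 0) = _
  have h (p : Fin N) := balanceTester_probFrom_letters (k := k) w p 0
  simp only [Pi.single_zero, zero_add] at h
  simp only [add_zero, h, ← Finset.mul_sum, Finset.sum_boole]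
  rw [div_eq_inv_mul]

theorem exists_recognizesWithError_balancedWords (k n : ℕ) {ε : ℝ} (hε : 0 < ε) :
    ∃ M : RealtimeQBCA (k + 1) (Fin (n + 1) × Bool),
      M.WellFormed ∧ M.RecognizesWithError ε (balancedWords (n + 1)) := by
  -- The imbalance polynomial has degree at most `n`, so `N > n / ε` pushes the fraction `n / N` of
  -- bad choices below `ε`.
  obtain ⟨N, hN⟩ := exists_nat_gt ((n : ℝ) / ε)
  have hN0 : (0 : ℝ) < N := lt_of_le_of_lt (by positivity) hN
  have : NeZero N := ⟨by exact_mod_cast hN0.ne'⟩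
  obtain ⟨M, hM, hprob⟩ := RealtimePBCA.exists_realtimeQBCA
    (P := balanceTester k (n + 1) N) (sum_balanceTester_prob k (n + 1) N)
  have hprob' (w) : M.acceptProb w = _ := (hprob w).trans (balanceTester_probFrom_tapeOf w)
  refine ⟨M, hM, fun w => ⟨fun hw => ?_, fun hw => ?_⟩⟩
  · rw [hprob', (imbalance_eq_zero_iff w).2 hw]
    simp [hN0.ne', hε.le]
  · rw [hprob', div_le_iff₀ hN0]
    refine le_trans (Nat.cast_le.2 (card_eval_imbalance_eq_zero_le hw N)) ?_
    rw [div_lt_iff₀ hε] at hN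
    linarith

end UpperBound

theorem mainTheorem11 (k : ℕ) (hk : 1 ≤ k) (ε : ℝ) (hε : 0 < ε) (hε' : ε < 1 / 2) :
    oneWayDBCALanguages k ⊂ realtimeQBCALanguages k ε := by
  refine ⟨oneWayDBCALanguages_subset k hε, fun h => ?_⟩
  -- The tester needs at least one counter, so `k` is written as `j + 1`; the language then has `k +
  -- 1 = j + 2` letter pairs.
  obtain ⟨j, rfl⟩ := Nat.exists_eq_add_of_le' hk
  obtain ⟨M, hM⟩ := @h ⟨Fin (j + 1 + 1) × Bool, inferInstance, balancedWords (j + 1 + 1)⟩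
    (exists_recognizesWithError_balancedWords j (j + 1) hε)
  exact not_recognizes_balancedWords (j + 1) M hM
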